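/- **Definitions.** Write $X^*$ for the conjugate transpose, $X^+$ for the Moore–Penrose pseudoinverse, and PSD for Hermitian positive semidefinite. Let $\varepsilon\ge 0$. For $A,\widetilde A\in\mathbb C^{m\times n}$ and PSD matrices $E\in\mathbb C^{m\times m}$, $F\in\mathbb C^{n\times n}$, say that $\widetilde A$ is an *$\varepsilon$-approximation of $A$ with respect to $E,F$* if $|x^*(\widetilde A-A)y|\le\frac{\varepsilon}{2}(x^*Ex+y^*Fy)$ for all $x\in\mathbb C^m$, $y\in\mathbb C^n$. *SV approximation.* For PSD $D_{\rm in}\in\mathbb C^{m\times m}$ and $D_{\rm out}\in\mathbb C^{n\times n}$, $\widetilde A$ is an $\varepsilon$-SV approximation of $A$ with respect to $D_{\rm in},D_{\rm out}$ if (i) $D_{\rm in}x=0$ implies $x^*A=0$, and $D_{\rm out}y=0$ implies $Ay=0$; (ii) $E=D_{\rm in}-AD_{\rm out}^+A^*$ and $F=D_{\rm out}-A^*D_{\rm in}^+A$ are PSD; (iii) $\widetilde A$ is an $\frac{\varepsilon}{2}$-approximation of $A$ with respect to $E,F$. It is a *graph* $\varepsilon$-SV approximation if $A$ is real and entrywise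 nonnegative, $D_{\rm in}={\rm diag}(A\mathbf 1)$ and $D_{\rm out}={\rm diag}(\mathbf 1^{\top}A)$. It is a *normalized* $\varepsilon$-SV approximation if $D_{\rm in}=I_m$ and $D_{\rm out}=I_n$. *UC approximation.* For $A,\widetilde A\in\mathbb C^{n\times n}$, $\widetilde A$ is an $\varepsilon$-UC (unit-circle) approximation of $A$ if, for every $z\in\mathbb C$ with $|z|=1$, the matrix $E_z=I-\frac12(zA+(zA)^*)$ is PSD and $z\widetilde A$ is an $\varepsilon$-approximation of $zA$ with respect to $E_z,E_z$. For $A\in\mathbb C^{m\times n}$ with $i+m\le M$ and $j+n\le N$, let $\mathcal L^{M,N}_{i,j}(A)\in\mathbb C^{M\times N}$ be the matrix that has $A$ as the contiguous block preceded by $i$ rows and $j$ columns, and zeros elsewhere. **Proposition.** SV approximation has the following three properties. 1. *(Permutations.)* Let $A,\widetilde A\in\mathbb C^{m\times n}$ and let $U$ ($m\times m$) and $V$ ($n\times n$) be permutation matrices. If $\widetilde A$ is an $\varepsilon$-SV approximation of $A$ with respect to $D_{\rm in},D_{\rm out}$, then $U\widetilde AV$ is an $\varepsilon$-SV approximation of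 $UAV$ with respect to $UD_{\rm in}U^*$, $V^*D_{\rm out}V$. If $\widetilde A$ is a graph (respectively normalized) $\varepsilon$-SV approximation of $A$, then $U\widetilde AV$ is a graph (respectively normalized) $\varepsilon$-SV approximation of $UAV$. 2. *(Embedding into block matrices.)* Let $A,\widetilde A\in\mathbb C^{m\times n}$, let $i,j,k,\ell\ge 0$ be integers, and put $M=i+m+\ell$, $N=j+n+k$. If $\widetilde A$ is an $\varepsilon$-SV approximation of $A$ with respect to $D_{\rm in},D_{\rm out}$, then $\mathcal L^{M,N}_{i,j}(\widetilde A)$ is an $\varepsilon$-SV approximation of $\mathcal L^{M,N}_{i,j}(A)$ with respect to $\mathcal L^{M,M}_{i,i}(D_{\rm in})$, $\mathcal L^{N,N}_{j,j}(D_{\rm out})$. If $\widetilde A$ is a graph (respectively normalized) $\varepsilon$-SV approximation of $A$, then so is $\mathcal L^{M,N}_{i,j}(\widetilde A)$ of $\mathcal L^{M,N}_{i,j}(A)$. 3. *(Products.)* For every $\varepsilon_0<1$ there is a constant $C\ge0$ such that for all $0\le\varepsilon\le\varepsilon_0$, all integers $\ell,n\ge0$ and all $N_1,\dots,N_\ell,\widetilde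 N_1,\dots,\widetilde N_\ell\in\mathbb C^{n\times n}$: if $\widetilde N_i$ is a normalized $\varepsilon$-SV approximation of $N_i$ for every $i$, then $\widetilde N_\ell\cdots\widetilde N_2\widetilde N_1$ is a normalized $(\varepsilon+C\varepsilon^2)$-SV approximation of $N_\ell\cdots N_2N_1$. None of these properties holds for UC approximation, even for real symmetric doubly stochastic matrices (random walk matrices of regular weighted undirected graphs) and with an arbitrary loss in the error. For all real $\varepsilon,K>0$: 4. there are symmetric doubly stochastic matrices $A,\widetilde A$ and a permutation matrix $U$ of the same size such that $\widetilde A$ is an $\varepsilon$-UC approximation of $A$, but $U\widetilde A$ is not a $K$-UC approximation of $UA$; 5. there are symmetric doubly stochastic $n\times n$ matrices $A,\widetilde A$ and integers $M,i,j\ge0$ with $i+n\le M$ and $j+n\le M$ such that $\widetilde A$ is an $\varepsilon$-UC approximation of $A$, but $\mathcal L^{M,M}_{i,j}(\widetilde A)$ is not a $K$-UC approximation of $\mathcal L^{M,M}_{i,j}(A)$; 6. there are symmetric doubly stochastic matrices $A_1,A_2,\widetilde A_1,\widetilde A_2$ of the same size such that $\widetilde A_t$ is an $\varepsilon$-UC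 approximation of $A_t$ for $t=1,2$, but $\widetilde A_2\widetilde A_1$ is not a $K$-UC approximation of $A_2A_1$. -/

import Mathlib

open Matrix

open scoped ComplexOrder

namespace SpectralApprox

section Pinv

variable {m n : Type*} [Fintype m] [Fintype n]

/-- `X` is a Moore-Penrose pseudoinverse of `M`: the four Penrose equations. -/
structure IsMoorePenrose (M : Matrix m n ℂ) (X : Matrix n m ℂ) : Prop where
  mul_mul_self : M * X * M = M
  self_mul_mul : X * M * X = X
  isHermitian_left : (M * X)ᴴ = M * X
  isHermitian_right : (X * M)ᴴ = X * M

theorem IsMoorePenrose.unique {M : Matrix m n ℂ} {X Y : Matrix n m ℂ}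
    (hX : IsMoorePenrose M X) (hY : IsMoorePenrose M Y) : X = Y := by
  have h1 : M * X = M * Y := by
    have : (M * X)ᴴ = (M * Y * (M * X))ᴴ := by
      rw [← Matrix.mul_assoc, hY.mul_mul_self]
    rw [hX.isHermitian_left, conjTranspose_mul, hX.isHermitian_left, hY.isHermitian_left,
      ← Matrix.mul_assoc, hX.mul_mul_self] at this
    exact this
  have h2 : X * M = Y * M := by
    have : (X * M)ᴴ = (X * M * (Y * M))ᴴ := by
      rw [Matrix.mul_assoc, ← Matrix.mul_assoc M, hY.mul_mul_self]
    rw [hX.isHermitian_right, conjTranspose_mul, hX.isHermitian_right, hY.isHermitian_right,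
      Matrix.mul_assoc, ← Matrix.mul_assoc M, hX.mul_mul_self] at this
    exact this
  calc X = X * M * X := hX.self_mul_mul.symm
    _ = Y * M * Y := by rw [h2, Matrix.mul_assoc, h1, ← Matrix.mul_assoc]
    _ = Y := hY.self_mul_mul

theorem exists_isMoorePenrose (M : Matrix m n ℂ) : ∃ X, IsMoorePenrose M X := by
  classical
  have hH : (Mᴴ * M).IsHermitian := isHermitian_conjTranspose_mul_self M
  obtain ⟨U, d, hU, hU', hd⟩ : ∃ (U : Matrix n n ℂ) (d : n → ℝ), Uᴴ * U = 1 ∧ U * Uᴴ = 1 ∧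
      Mᴴ * M = U * diagonal (fun i => (d i : ℂ)) * Uᴴ := by
    refine ⟨hH.eigenvectorUnitary, hH.eigenvalues, ?_, ?_, ?_⟩
    · exact Unitary.coe_star_mul_self hH.eigenvectorUnitary
    · exact Unitary.coe_mul_star_self hH.eigenvectorUnitary
    · have := hH.spectral_theorem
      rw [Unitary.conjStarAlgAut_apply] at this
      exact this
  set H := Mᴴ * M with hHdef
  set G := U * diagonal (fun i => ((d i)⁻¹ : ℂ)) * Uᴴ with hG
  have key : ∀ D E : Matrix n n ℂ, U * D * Uᴴ * (U * E * Uᴴ) = U * (D * E) * Uᴴ := by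
    intro D E
    calc U * D * Uᴴ * (U * E * Uᴴ) = U * D * (Uᴴ * U) * E * Uᴴ := by
          simp only [Matrix.mul_assoc]
      _ = U * (D * E) * Uᴴ := by rw [hU, Matrix.mul_one]; simp only [Matrix.mul_assoc]
  have hGH : (G)ᴴ = G := by
    rw [hG]
    simp only [conjTranspose_mul, conjTranspose_conjTranspose, diagonal_conjTranspose,
      Matrix.mul_assoc]
    congr 3
    ext i
    simp
  have hcomm : G * H = H * G := by
    rw [hd, hG, key, key, diagonal_mul_diagonal, diagonal_mul_diagonal]
    simp only [mul_comm]
  have hGHG : G * H * G = G := by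
    rw [hd, hG, key, key, diagonal_mul_diagonal, diagonal_mul_diagonal]
    congr 3
    ext i
    by_cases h : (d i : ℂ) = 0
    · simp [h]
    · field_simp
  have hHGH : H * G * H = H := by
    rw [hd, hG, key, key, diagonal_mul_diagonal, diagonal_mul_diagonal]
    congr 3
    ext i
    by_cases h : (d i : ℂ) = 0
    · simp [h]
    · field_simp
  have hHH : Hᴴ = H := hH
  have hA : M * G * H = M := by
    have h0 : (M - M * G * H)ᴴ * (M - M * G * H) = 0 := by
      have e1 : (M - M * G * H)ᴴ = Mᴴ - H * G * Mᴴ := by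
        rw [conjTranspose_sub, conjTranspose_mul (M * G) H, conjTranspose_mul M G, hGH, hHH,
          ← Matrix.mul_assoc]
      have e2 : Mᴴ * (M - M * G * H) = 0 := by
        rw [Matrix.mul_sub, ← Matrix.mul_assoc, ← Matrix.mul_assoc Mᴴ M G, ← hHdef, hHGH,
          sub_self]
      rw [e1, Matrix.sub_mul, e2, Matrix.mul_assoc, e2, Matrix.mul_zero, sub_zero]
    have h1 := conjTranspose_mul_self_eq_zero.mp h0
    exact (sub_eq_zero.mp h1).symm
  refine ⟨G * Mᴴ, ?_, ?_, ?_, ?_⟩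
  · rw [Matrix.mul_assoc, Matrix.mul_assoc, ← hHdef, ← Matrix.mul_assoc, hA]
  · calc G * Mᴴ * M * (G * Mᴴ) = G * (Mᴴ * M) * G * Mᴴ := by simp only [Matrix.mul_assoc]
      _ = G * Mᴴ := by rw [← hHdef, hGHG]
  · simp only [conjTranspose_mul, conjTranspose_conjTranspose, hGH, Matrix.mul_assoc]
  · rw [Matrix.mul_assoc, ← hHdef, conjTranspose_mul, hGH, hHH, hcomm]

/-- The Moore-Penrose pseudoinverse `M⁺`. -/
noncomputable def pinv (M : Matrix m n ℂ) : Matrix n m ℂ :=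
  (exists_isMoorePenrose M).choose

theorem pinv_isMoorePenrose (M : Matrix m n ℂ) : IsMoorePenrose M (pinv M) :=
  (exists_isMoorePenrose M).choose_spec

end Pinv

section Approx

variable {m n : Type*} [Fintype m] [Fintype n]

/-- The quadratic form `x* E x` (a real number when `E` is Hermitian). -/
def quadForm (E : Matrix n n ℂ) (x : n → ℂ) : ℝ := (star x ⬝ᵥ (E *ᵥ x)).re

/-- `A'` is an `ε`-approximation of `A` with respect to the (PSD) error matrices `E` and `F`. -/
def MatrixApprox (ε : ℝ) (E : Matrix m m ℂ) (F : Matrix n n ℂ) (A' A : Matrix m n ℂ) : Prop :=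
  0 ≤ ε ∧ E.PosSemidef ∧ F.PosSemidef ∧
    ∀ (x : m → ℂ) (y : n → ℂ),
      ‖star x ⬝ᵥ ((A' - A) *ᵥ y)‖ ≤ ε / 2 * (quadForm E x + quadForm F y)

/-- The symmetrization `S_M = (M + M*) / 2`. -/
noncomputable def symPart (M : Matrix n n ℂ) : Matrix n n ℂ := (1 / 2 : ℂ) • (M + Mᴴ)

/-- `A'` is a standard `ε`-approximation of `A` with respect to the degree matrix `D`. -/
def StdApprox (ε : ℝ) (D A' A : Matrix n n ℂ) : Prop :=
  D.PosSemidef ∧ (D - symPart A).PosSemidef ∧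
    MatrixApprox ε (D - symPart A) (D - symPart A) A' A

/-- `A'` is a unit-circle `ε`-approximation of `A` with respect to the degree matrix `D`. -/
def UCApprox (ε : ℝ) (D A' A : Matrix n n ℂ) : Prop :=
  ∀ z : ℂ, ‖z‖ = 1 → StdApprox ε D (z • A') (z • A)

/-- `A'` is an `ε`-singular-value approximation of `A` with respect to the degree matrices
`Din` and `Dout`. -/
def SVApprox (ε : ℝ) (Din : Matrix m m ℂ) (Dout : Matrix n n ℂ) (A' A : Matrix m n ℂ) : Prop :=
  Din.PosSemidef ∧ Dout.PosSemidef ∧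
    (∀ x : m → ℂ, Din *ᵥ x = 0 → star x ᵥ* A = 0) ∧
    (∀ y : n → ℂ, Dout *ᵥ y = 0 → A *ᵥ y = 0) ∧
    (Din - A * pinv Dout * Aᴴ).PosSemidef ∧
    (Dout - Aᴴ * pinv Din * A).PosSemidef ∧
    MatrixApprox (ε / 2) (Din - A * pinv Dout * Aᴴ) (Dout - Aᴴ * pinv Din * A) A' A

/-- SV approximation of an entrywise nonnegative real matrix with respect to its row sums and
column sums. -/
def SVGraph [DecidableEq m] [DecidableEq n] (ε : ℝ) (A' A : Matrix m n ℂ) : Prop :=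
  (∀ i j, 0 ≤ (A i j).re ∧ (A i j).im = 0) ∧
    SVApprox ε (diagonal (A *ᵥ 1)) (diagonal (1 ᵥ* A)) A' A

/-- Normalized SV approximation: both degree matrices are the identity. -/
def SVNorm [DecidableEq m] [DecidableEq n] (ε : ℝ) (A' A : Matrix m n ℂ) : Prop :=
  SVApprox ε 1 1 A' A

/-- Unit-circle approximation with respect to the identity. -/
def UCNorm [DecidableEq n] (ε : ℝ) (A' A : Matrix n n ℂ) : Prop :=
  UCApprox ε 1 A' A

/-- Real symmetric doubly stochastic matrices, viewed as complex matrices: the random walk matrices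
of regular (weighted) undirected graphs. -/
def IsUndirectedWalk [DecidableEq n] (A : Matrix n n ℂ) : Prop :=
  ∃ W : Matrix n n ℝ, W ∈ doublyStochastic ℝ n ∧ W.IsSymm ∧ A = W.map Complex.ofReal

end Approx

/-- The `M × N` matrix that contains the `m × n` matrix `A` as the contiguous block with rows
`i, …, i + m - 1` and columns `j, …, j + n - 1` (counted from `0`), and zeros elsewhere.
It is used only where `i + m ≤ M` and `j + n ≤ N`. -/
def embedAt (M N i j : ℕ) {m n : ℕ} (A : Matrix (Fin m) (Fin n) ℂ) :
    Matrix (Fin M) (Fin N) ℂ :=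
  fun r c =>
    if h : (i ≤ r.1 ∧ r.1 - i < m) ∧ (j ≤ c.1 ∧ c.1 - j < n) then
      A ⟨r.1 - i, h.1.2⟩ ⟨c.1 - j, h.2.2⟩
    else 0

/-- The product `N_ℓ ⋯ N_2 N_1`. -/
def descProd {ℓ n : ℕ} (N : Fin ℓ → Matrix (Fin n) (Fin n) ℂ) : Matrix (Fin n) (Fin n) ℂ :=
  (List.ofFn N).reverse.prod

end SpectralApprox

set_option linter.unusedSectionVars false

/-! Permuting and embedding are both instances of `A ↦ J * A * Kᴴ` with isometries `J` and `K`.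
Pseudoinverses commute with conjugation by an isometry, so the error matrices become `J * E * Jᴴ`
and `K * F * Kᴴ`, and testing on `x, y` reduces to testing on `Jᴴ *ᵥ x, Kᴴ *ᵥ y`
(`SVApprox.isometry_conj`).

For products, call `|x|² - |Mᴴ x|²` the defect of `Mᴴ` at `x`. The difference of the two products is
a sum of terms with approximate factors on the left and exact ones on the right. On the right the
defects telescope exactly. On the left they telescope after each exact factor's defect is replaced
by the approximate one's, at the cost of a factor `1 / (1 - ε)` (`SVNorm.one_sub_mul_le`,
`descProd_approx`). A second factor `1 / (1 - ε)` turns the defect of the approximate product back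
into that of the exact one (`defect_le_of_approx`). The error is thus at most `ε / (1 - ε)²`,
whatever the number of factors.

For UC approximation, a small relative perturbation of the entries of a symmetric doubly stochastic
matrix is harmless (`ucNorm_of_entrywise`), but for a directed walk it is not. On a long lazy
directed cycle with a root of unity `ω` near `1`, changing the laziness moves the eigenvalue by
order `|1 - ω|`, while the error form is of order `|1 - ω|²` (`exists_doublyStochastic_far`). The
symmetric lift `[0, B; Bᵀ, 0]` hides the cycle `B` off the diagonal. A permutation, an off-diagonal
embedding, or a product with a permutation moves `B` to a diagonal block, where `z = 1` exposes the
failure. -/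

namespace SpectralApprox

/-! ### Euclidean norms and quadratic forms. -/

section Basic

variable {m n : Type*} [Fintype m] [Fintype n]

/-- The squared Euclidean norm of a complex vector. -/
noncomputable def sqNorm (x : n → ℂ) : ℝ := ∑ i, ‖x i‖ ^ 2

theorem sqNorm_nonneg (x : n → ℂ) : 0 ≤ sqNorm x :=
  Finset.sum_nonneg fun _ _ => sq_nonneg _

theorem star_dotProduct_self (x : n → ℂ) : star x ⬝ᵥ x = (sqNorm x : ℂ) := by
  simp only [dotProduct, sqNorm, Complex.ofReal_sum, Complex.ofReal_pow, Pi.star_apply]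
  exact Finset.sum_congr rfl fun i _ => Complex.conj_mul' (x i)

theorem re_star_dotProduct_self (x : n → ℂ) : (star x ⬝ᵥ x).re = sqNorm x := by
  rw [star_dotProduct_self, Complex.ofReal_re]

theorem norm_star_dotProduct_le (x y : n → ℂ) :
    ‖star x ⬝ᵥ y‖ ≤ (sqNorm x + sqNorm y) / 2 := by
  calc ‖star x ⬝ᵥ y‖ ≤ ∑ i, ‖star (x i) * y i‖ := norm_sum_le _ _
    _ ≤ ∑ i, (‖x i‖ ^ 2 + ‖y i‖ ^ 2) / 2 := by
        refine Finset.sum_le_sum fun i _ => ?_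
        rw [norm_mul, norm_star]
        nlinarith [sq_nonneg (‖x i‖ - ‖y i‖)]
    _ = (sqNorm x + sqNorm y) / 2 := by
        rw [← Finset.sum_div, Finset.sum_add_distrib, sqNorm, sqNorm]

theorem star_dotProduct_mulVec (A : Matrix m n ℂ) (x : m → ℂ) (y : n → ℂ) :
    star x ⬝ᵥ (A *ᵥ y) = star (Aᴴ *ᵥ x) ⬝ᵥ y := by
  rw [dotProduct_mulVec, star_mulVec, conjTranspose_conjTranspose]

theorem star_star_dotProduct (x y : n → ℂ) : star (star x ⬝ᵥ y) = star y ⬝ᵥ x := by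
  simp [dotProduct, mul_comm]

theorem norm_star_dotProduct_comm (x y : n → ℂ) : ‖star x ⬝ᵥ y‖ = ‖star y ⬝ᵥ x‖ := by
  rw [← norm_star (star x ⬝ᵥ y), star_star_dotProduct]

theorem sqNorm_smul (c : ℝ) (x : n → ℂ) : sqNorm ((c : ℂ) • x) = c ^ 2 * sqNorm x := by
  simp [sqNorm, Finset.mul_sum, mul_pow]

theorem sqNorm_add (x y : n → ℂ) :
    sqNorm (x + y) = sqNorm x + 2 * (star x ⬝ᵥ y).re + sqNorm y := by
  rw [← re_star_dotProduct_self, ← re_star_dotProduct_self x, ← re_star_dotProduct_self y,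
    star_add, add_dotProduct, dotProduct_add, dotProduct_add]
  have : (star y ⬝ᵥ x).re = (star x ⬝ᵥ y).re := by
    rw [← star_star_dotProduct]
    rfl
  simp only [Complex.add_re, this]
  ring

theorem quadForm_mul_mul_conjTranspose (J : Matrix m n ℂ) (E : Matrix n n ℂ) (x : m → ℂ) :
    quadForm (J * E * Jᴴ) x = quadForm E (Jᴴ *ᵥ x) := by
  rw [quadForm, quadForm, ← mulVec_mulVec, ← mulVec_mulVec, star_dotProduct_mulVec]

theorem posSemidef_of_quadForm_nonneg {E : Matrix n n ℂ} (hE : E.IsHermitian)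
    (h : ∀ x, 0 ≤ quadForm E x) : E.PosSemidef := by
  refine PosSemidef.of_dotProduct_mulVec_nonneg hE fun x => ?_
  rw [Complex.nonneg_iff]
  refine ⟨h x, ?_⟩
  have : star (star x ⬝ᵥ (E *ᵥ x)) = star x ⬝ᵥ (E *ᵥ x) := by
    rw [star_star_dotProduct, star_dotProduct_mulVec, hE.eq]
  exact (Complex.conj_eq_iff_im.mp this).symm

theorem quadForm_nonneg {E : Matrix n n ℂ} (hE : E.PosSemidef) (x : n → ℂ) :
    0 ≤ quadForm E x :=
  (Complex.nonneg_iff.mp (hE.dotProduct_mulVec_nonneg x)).1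

theorem quadForm_one_sub_mul_conjTranspose [DecidableEq m] (A : Matrix m n ℂ) (x : m → ℂ) :
    quadForm (1 - A * Aᴴ) x = sqNorm x - sqNorm (Aᴴ *ᵥ x) := by
  rw [quadForm, sub_mulVec, dotProduct_sub, one_mulVec, ← mulVec_mulVec, star_dotProduct_mulVec,
    Complex.sub_re, re_star_dotProduct_self, re_star_dotProduct_self]

/-- `|Aᴴ x|² = Re (x* A Aᴴ x) ≤ (|x|² + |A Aᴴ x|²) / 2`, and contractivity of `A` lets the left side
absorb the last term. -/
theorem sqNorm_conjTranspose_mulVec_le {A : Matrix m n ℂ}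
    (hA : ∀ y, sqNorm (A *ᵥ y) ≤ sqNorm y) (x : m → ℂ) : sqNorm (Aᴴ *ᵥ x) ≤ sqNorm x := by
  have h1 := re_star_dotProduct_self (Aᴴ *ᵥ x)
  rw [← star_dotProduct_mulVec] at h1
  have h2 := norm_star_dotProduct_le x (A *ᵥ Aᴴ *ᵥ x)
  have h3 := Complex.re_le_norm (star x ⬝ᵥ A *ᵥ Aᴴ *ᵥ x)
  linarith [hA (Aᴴ *ᵥ x)]

end Basic

/-! ### Normalized SV approximation in terms of norms. -/

section Normalized

variable {m n : Type*} [Fintype m] [Fintype n] [DecidableEq m] [DecidableEq n]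

theorem pinv_one : pinv (1 : Matrix n n ℂ) = 1 :=
  (pinv_isMoorePenrose 1).unique ⟨by simp, by simp, by simp, by simp⟩

/-- With identity degrees the kernel conditions are vacuous, and both PSD conditions say that `A` is
a contraction. The constant `ε / 4` combines the `ε / 2` of SV approximation with the `1 / 2` of
matrix approximation. -/
theorem svNorm_iff {ε : ℝ} {A A' : Matrix m n ℂ} :
    SVNorm ε A' A ↔ 0 ≤ ε ∧ (∀ y, sqNorm (A *ᵥ y) ≤ sqNorm y) ∧
      ∀ x y, ‖star x ⬝ᵥ ((A' - A) *ᵥ y)‖ ≤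
        ε / 4 * (sqNorm x - sqNorm (Aᴴ *ᵥ x) + (sqNorm y - sqNorm (A *ᵥ y))) := by
  have hF : ∀ y, quadForm (1 - Aᴴ * A) y = sqNorm y - sqNorm (A *ᵥ y) := fun y => by
    simpa using quadForm_one_sub_mul_conjTranspose Aᴴ y
  simp only [SVNorm, SVApprox, MatrixApprox, pinv_one, Matrix.mul_one, hF,
    quadForm_one_sub_mul_conjTranspose]
  constructor
  · rintro ⟨-, -, -, -, -, h, hε, -, -, h'⟩
    refine ⟨by linarith, fun y => ?_, fun x y => ?_⟩
    · have := quadForm_nonneg h y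
      rw [hF] at this
      linarith
    · refine (h' x y).trans (le_of_eq ?_)
      ring
  · rintro ⟨hε, hA, h⟩
    have hE' : (1 - A * Aᴴ).PosSemidef := by
      refine posSemidef_of_quadForm_nonneg
        (isHermitian_one.sub (isHermitian_mul_conjTranspose_self A)) fun x => ?_
      rw [quadForm_one_sub_mul_conjTranspose]
      linarith [sqNorm_conjTranspose_mulVec_le hA x]
    have hF' : (1 - Aᴴ * A).PosSemidef := by
      refine posSemidef_of_quadForm_nonneg
        (isHermitian_one.sub (isHermitian_conjTranspose_mul_self A)) fun x => ?_
      rw [hF]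
      linarith [hA x]
    refine ⟨PosSemidef.one, PosSemidef.one, ?_, ?_, hE', hF', by linarith, hE', hF', ?_⟩
    · intro x hx
      rw [one_mulVec] at hx
      simp [hx]
    · intro y hy
      rw [one_mulVec] at hy
      simp [hy]
    · intro x y
      refine (h x y).trans (le_of_eq ?_)
      ring

/-- An SV approximation of a contraction loses at most a factor `1 - ε` in `I - A A*`. -/
theorem SVNorm.one_sub_mul_le {ε : ℝ} {A A' : Matrix m n ℂ} (h : SVNorm ε A' A) (hε : ε ≤ 1)
    (x : m → ℂ) :
    (1 - ε) * (sqNorm x - sqNorm (Aᴴ *ᵥ x)) ≤ sqNorm x - sqNorm (A'ᴴ *ᵥ x) := by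
  obtain ⟨hε0, -, h⟩ := svNorm_iff.mp h
  set y := A'ᴴ *ᵥ x with hy
  have h1 : star x ⬝ᵥ (A *ᵥ y) + star x ⬝ᵥ ((A' - A) *ᵥ y) = (sqNorm y : ℂ) := by
    rw [sub_mulVec, dotProduct_sub, add_sub_cancel, star_dotProduct_mulVec, ← hy,
      star_dotProduct_self]
  have h2 : sqNorm y ≤ ‖star x ⬝ᵥ (A *ᵥ y)‖ + ‖star x ⬝ᵥ ((A' - A) *ᵥ y)‖ := by
    calc sqNorm y = ‖(sqNorm y : ℂ)‖ := by
          rw [Complex.norm_real, Real.norm_of_nonneg (sqNorm_nonneg y)]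
      _ ≤ _ := by rw [← h1]; exact norm_add_le _ _
  -- Two AM-GM bounds for the same number `x* A y`. Taken with weights `ε / 2` and `1 - ε / 2`, they
  -- cancel the defect of `A` at `y` and leave the defect at `x` with coefficient `(1 - ε / 2)² - (ε
  -- / 2)² = 1 - ε`.
  have h3 := norm_star_dotProduct_le x (A *ᵥ y)
  have h4 := norm_star_dotProduct_le (Aᴴ *ᵥ x) y
  rw [← star_dotProduct_mulVec] at h4
  have h5 := h x y
  nlinarith

theorem SVNorm.contraction {ε : ℝ} {A A' : Matrix m n ℂ} (h : SVNorm ε A' A) (hε : ε ≤ 1)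
    (y : n → ℂ) : sqNorm (A' *ᵥ y) ≤ sqNorm y := by
  obtain ⟨hε0, hA, -⟩ := svNorm_iff.mp h
  have key : ∀ x, sqNorm (A'ᴴ *ᵥ x) ≤ sqNorm x := fun x => by
    have h1 := h.one_sub_mul_le hε x
    have h2 := sqNorm_conjTranspose_mulVec_le hA x
    nlinarith
  simpa using sqNorm_conjTranspose_mulVec_le key y

end Normalized

/-! ### Products of normalized SV approximations. -/

section Products

theorem descProd_zero {n : ℕ} (N : Fin 0 → Matrix (Fin n) (Fin n) ℂ) : descProd N = 1 := by
  simp [descProd]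

theorem descProd_succ {ℓ n : ℕ} (N : Fin (ℓ + 1) → Matrix (Fin n) (Fin n) ℂ) :
    descProd N = N (Fin.last ℓ) * descProd (fun i => N i.castSucc) := by
  rw [descProd, List.ofFn_succ', List.concat_eq_append, List.reverse_append]
  simp [descProd]

variable {n : ℕ}

/-- The bound is deliberately asymmetric: the defect at `x` belongs to the approximate product, the
one at `y` to the exact product. These are the defects that telescope under `B' P' - B P = B' (P' -
P) + (B' - B) P`. -/
theorem descProd_approx {ε : ℝ} (hε : ε < 1) :
    ∀ {ℓ : ℕ} (N N' : Fin ℓ → Matrix (Fin n) (Fin n) ℂ), (∀ i, SVNorm ε (N' i) (N i)) →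
      (∀ y, sqNorm (descProd N *ᵥ y) ≤ sqNorm y) ∧
      (∀ y, sqNorm (descProd N' *ᵥ y) ≤ sqNorm y) ∧
      ∀ x y, (1 - ε) * ‖star x ⬝ᵥ ((descProd N' - descProd N) *ᵥ y)‖ ≤
        ε / 4 * (sqNorm x - sqNorm ((descProd N')ᴴ *ᵥ x) +
          (1 - ε) * (sqNorm y - sqNorm (descProd N *ᵥ y)))
  | 0, N, N', _ => by
    simp [descProd_zero]
  | ℓ + 1, N, N', h => by
    obtain ⟨hP, hP', hd⟩ := descProd_approx hε (fun i => N i.castSucc) (fun i => N' i.castSucc)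
      (fun i => h i.castSucc)
    rw [descProd_succ N, descProd_succ N']
    set P := descProd (fun i => N i.castSucc)
    set P' := descProd (fun i => N' i.castSucc)
    have hl := h (Fin.last ℓ)
    set B := N (Fin.last ℓ)
    set B' := N' (Fin.last ℓ)
    obtain ⟨hε0, hB, hBB⟩ := svNorm_iff.mp hl
    refine ⟨fun y => ?_, fun y => ?_, fun x y => ?_⟩
    · rw [← mulVec_mulVec]
      exact (hB _).trans (hP y)
    · rw [← mulVec_mulVec]
      exact (hl.contraction hε.le _).trans (hP' y)
    · have e : star x ⬝ᵥ ((B' * P' - B * P) *ᵥ y) =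
          star (B'ᴴ *ᵥ x) ⬝ᵥ ((P' - P) *ᵥ y) + star x ⬝ᵥ ((B' - B) *ᵥ (P *ᵥ y)) := by
        rw [← star_dotProduct_mulVec, ← dotProduct_add, mulVec_mulVec, mulVec_mulVec,
          ← add_mulVec, Matrix.mul_sub, Matrix.sub_mul, sub_add_sub_cancel]
      have h1 := hd (B'ᴴ *ᵥ x) y
      have h2 := hBB x (P *ᵥ y)
      have h3 := hl.one_sub_mul_le hε.le x
      have h4 := norm_add_le (star (B'ᴴ *ᵥ x) ⬝ᵥ ((P' - P) *ᵥ y))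
        (star x ⬝ᵥ ((B' - B) *ᵥ (P *ᵥ y)))
      rw [e, conjTranspose_mul, ← mulVec_mulVec, ← mulVec_mulVec]
      have h5 := mul_le_mul_of_nonneg_left h4 (sub_nonneg.mpr hε.le)
      have h6 := mul_le_mul_of_nonneg_left h2 (sub_nonneg.mpr hε.le)
      have h7 := mul_le_mul_of_nonneg_left h3 (show 0 ≤ ε / 4 by linarith)
      linarith

/-- If `P'` approximates `P` up to an error measured by the defects of `P'*` and `P`, then the
defect of `P'*` is controlled by that of `P*`. -/
theorem defect_le_of_approx {ε : ℝ} (hε0 : 0 ≤ ε) (hε : ε < 1) {P P' : Matrix (Fin n) (Fin n) ℂ}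
    (hd : ∀ x y, (1 - ε) * ‖star x ⬝ᵥ ((P' - P) *ᵥ y)‖ ≤
        ε / 4 * (sqNorm x - sqNorm (P'ᴴ *ᵥ x) + (1 - ε) * (sqNorm y - sqNorm (P *ᵥ y))))
    (x : Fin n → ℂ) :
    (1 - ε) * (sqNorm x - sqNorm (P'ᴴ *ᵥ x)) ≤ sqNorm x - sqNorm (Pᴴ *ᵥ x) := by
  have hpos : 0 < 1 - ε := by linarith
  -- Scaling `x` by `s` and `y` by `s⁻¹` keeps the bilinear form and moves the weight `1 - ε` from
  -- the defect at `y` to the defect at `x`.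
  set s : ℝ := Real.sqrt (1 - ε) with hs
  have hs2 : s ^ 2 = 1 - ε := Real.sq_sqrt hpos.le
  have hs0 : s ≠ 0 := (Real.sqrt_pos.mpr hpos).ne'
  set y := Pᴴ *ᵥ x with hy
  have h1 := hd ((s : ℂ) • x) (((s⁻¹ : ℝ) : ℂ) • y)
  have e1 : star ((s : ℂ) • x) ⬝ᵥ ((P' - P) *ᵥ (((s⁻¹ : ℝ) : ℂ) • y)) =
      star x ⬝ᵥ ((P' - P) *ᵥ y) := by
    rw [mulVec_smul, star_smul, smul_dotProduct, dotProduct_smul, smul_smul]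
    have : star (s : ℂ) * ((s⁻¹ : ℝ) : ℂ) = 1 := by
      rw [Complex.star_def, Complex.conj_ofReal, ← Complex.ofReal_mul, mul_inv_cancel₀ hs0,
        Complex.ofReal_one]
    rw [this, one_smul]
  rw [e1, mulVec_smul, mulVec_smul, sqNorm_smul, sqNorm_smul, sqNorm_smul, sqNorm_smul, inv_pow,
    hs2] at h1
  have h2 : (1 - ε) * ((1 - ε)⁻¹ * sqNorm y - (1 - ε)⁻¹ * sqNorm (P *ᵥ y)) =
      sqNorm y - sqNorm (P *ᵥ y) := by
    field_simp
  rw [h2] at h1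
  have h3 : sqNorm (P'ᴴ *ᵥ x) =
      sqNorm y + 2 * (star y ⬝ᵥ ((P' - P)ᴴ *ᵥ x)).re + sqNorm ((P' - P)ᴴ *ᵥ x) := by
    rw [← sqNorm_add, hy, ← add_mulVec, ← conjTranspose_add, add_sub_cancel]
  have h4 : -‖star x ⬝ᵥ ((P' - P) *ᵥ y)‖ ≤ (star y ⬝ᵥ ((P' - P)ᴴ *ᵥ x)).re := by
    rw [star_dotProduct_mulVec, norm_star_dotProduct_comm]
    exact (abs_le.mp (Complex.abs_re_le_norm _)).1
  have h5 : sqNorm y - sqNorm (P *ᵥ y) ≤ sqNorm x - sqNorm y := by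
    have h6 := re_star_dotProduct_self y
    have h7 : star y ⬝ᵥ y = star x ⬝ᵥ (P *ᵥ y) := (star_dotProduct_mulVec P x y).symm
    rw [h7] at h6
    linarith [Complex.re_le_norm (star x ⬝ᵥ (P *ᵥ y)), norm_star_dotProduct_le x (P *ᵥ y)]
  have h8 := sqNorm_nonneg ((P' - P)ᴴ *ᵥ x)
  have h9 := mul_le_mul_of_nonneg_left h5 hε0
  set a' := sqNorm x - sqNorm (P'ᴴ *ᵥ x) with ha'
  set a := sqNorm x - sqNorm y with ha
  have h10 : a' - a ≤ 2 * ‖star x ⬝ᵥ ((P' - P) *ᵥ y)‖ := by linarith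
  have h11 := mul_le_mul_of_nonneg_left h10 hpos.le
  -- From `(1 - ε) (a' - a) ≤ ε / 2 * ((1 - ε) a' + a)`; collecting terms gives the same factor `1 -
  -- ε / 2` on both sides.
  have h12 : (1 - ε / 2) * ((1 - ε) * a') ≤ (1 - ε / 2) * a := by
    rw [← mul_sub] at h1
    linarith
  exact le_of_mul_le_mul_left h12 (by linarith)

theorem svNorm_descProd {ε ε₀ : ℝ} (hε₀ : ε₀ < 1) (hε0 : 0 ≤ ε) (hε : ε ≤ ε₀) {ℓ : ℕ}
    (N N' : Fin ℓ → Matrix (Fin n) (Fin n) ℂ) (h : ∀ i, SVNorm ε (N' i) (N i)) :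
    SVNorm (ε + 2 / (1 - ε₀) ^ 2 * ε ^ 2) (descProd N') (descProd N) := by
  have hε1 : ε < 1 := by linarith
  obtain ⟨hP, -, hd⟩ := descProd_approx hε1 N N' h
  have hdef := defect_le_of_approx hε0 hε1 hd
  set P := descProd N
  set P' := descProd N'
  refine svNorm_iff.mpr ⟨by positivity, hP, fun x y => ?_⟩
  have h1 := hd x y
  have h2 := hdef x
  have h3 := sqNorm_conjTranspose_mulVec_le hP x
  have h4 := hP y
  set a' := sqNorm x - sqNorm (P'ᴴ *ᵥ x)
  set a := sqNorm x - sqNorm (Pᴴ *ᵥ x)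
  set b := sqNorm y - sqNorm (P *ᵥ y)
  have ha : 0 ≤ a := sub_nonneg.mpr h3
  have hb : 0 ≤ b := sub_nonneg.mpr h4
  have hpos : 0 < 1 - ε := by linarith
  have hpos0 : 0 < 1 - ε₀ := by linarith
  -- This is `1 / (1 - ε)² ≤ 1 + C ε`. The choice of `C` rests on `(1 - ε)² + 2 ε = 1 + ε²`.
  have hC : 1 ≤ (1 - ε) ^ 2 * (1 + 2 / (1 - ε₀) ^ 2 * ε) := by
    have : 2 / (1 - ε) ^ 2 ≤ 2 / (1 - ε₀) ^ 2 := by gcongr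
    have e : (1 - ε) ^ 2 * (1 + 2 / (1 - ε) ^ 2 * ε) = 1 + ε ^ 2 := by
      field_simp
      ring
    calc (1 : ℝ) ≤ 1 + ε ^ 2 := by linarith [sq_nonneg ε]
      _ ≤ _ := by rw [← e]; gcongr
  set c := 1 + 2 / (1 - ε₀) ^ 2 * ε with hc
  have hc1 : 1 ≤ c := by
    have : 0 ≤ 2 / (1 - ε₀) ^ 2 * ε := by positivity
    linarith
  have h5 : a' ≤ (1 - ε) * (c * a) := by
    have : (1 - ε) * a' ≤ (1 - ε) * ((1 - ε) * (c * a)) := by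
      calc (1 - ε) * a' ≤ 1 * a := by linarith
        _ ≤ (1 - ε) ^ 2 * c * a := by gcongr
        _ = _ := by ring
    exact le_of_mul_le_mul_left this hpos
  have h6 : b ≤ c * b := by nlinarith
  have h7 : (1 - ε) * ‖star x ⬝ᵥ ((P' - P) *ᵥ y)‖ ≤ (1 - ε) * (ε / 4 * (c * (a + b))) := by
    refine h1.trans ?_
    calc ε / 4 * (a' + (1 - ε) * b) ≤ ε / 4 * ((1 - ε) * (c * a) + (1 - ε) * (c * b)) := by
          gcongr
      _ = _ := by ring
  refine (le_of_mul_le_mul_left h7 hpos).trans (le_of_eq ?_)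
  rw [hc]
  ring

end Products

/-! ### Conjugation by isometries. -/

section Isometry

variable {m n m' n' : Type*} [Fintype m] [Fintype n] [Fintype m'] [Fintype n']
  [DecidableEq m] [DecidableEq n] {J : Matrix m' m ℂ} {K : Matrix n' n ℂ}

/-- Since `Jᴴ * J = 1`, the map `X ↦ J * X * Jᴴ` respects products and adjoints, so it carries the
Penrose equations over; uniqueness does the rest. -/
theorem pinv_isometry_conj (hJ : Jᴴ * J = 1) (D : Matrix m m ℂ) :
    pinv (J * D * Jᴴ) = J * pinv D * Jᴴ := by
  have hD := pinv_isMoorePenrose D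
  have key : ∀ X Y : Matrix m m ℂ, J * X * Jᴴ * (J * Y * Jᴴ) = J * (X * Y) * Jᴴ := by
    intro X Y
    calc J * X * Jᴴ * (J * Y * Jᴴ) = J * X * (Jᴴ * J) * Y * Jᴴ := by simp only [Matrix.mul_assoc]
      _ = _ := by rw [hJ, Matrix.mul_one]; simp only [Matrix.mul_assoc]
  have star_key : ∀ X : Matrix m m ℂ, (J * X * Jᴴ)ᴴ = J * Xᴴ * Jᴴ := by
    intro X
    simp [Matrix.mul_assoc]
  refine (pinv_isMoorePenrose _).unique ⟨?_, ?_, ?_, ?_⟩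
  · rw [key, key, hD.mul_mul_self]
  · rw [key, key, hD.self_mul_mul]
  · rw [key, star_key, hD.isHermitian_left]
  · rw [key, star_key, hD.isHermitian_right]

theorem conjTranspose_isometry_conj (A : Matrix m n ℂ) : (J * A * Kᴴ)ᴴ = K * Aᴴ * Jᴴ := by
  simp [Matrix.mul_assoc]

theorem schur_isometry_conj (hK : Kᴴ * K = 1) (A : Matrix m n ℂ) (Din : Matrix m m ℂ)
    (Dout : Matrix n n ℂ) :
    J * Din * Jᴴ - J * A * Kᴴ * pinv (K * Dout * Kᴴ) * (J * A * Kᴴ)ᴴ =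
      J * (Din - A * pinv Dout * Aᴴ) * Jᴴ := by
  have e : J * A * Kᴴ * (K * pinv Dout * Kᴴ) * (K * Aᴴ * Jᴴ) = J * (A * pinv Dout * Aᴴ) * Jᴴ := by
    calc J * A * Kᴴ * (K * pinv Dout * Kᴴ) * (K * Aᴴ * Jᴴ)
        = J * A * (Kᴴ * K) * pinv Dout * (Kᴴ * K) * Aᴴ * Jᴴ := by simp only [Matrix.mul_assoc]
      _ = _ := by rw [hK, Matrix.mul_one, Matrix.mul_one]; simp only [Matrix.mul_assoc]
  rw [pinv_isometry_conj hK, conjTranspose_isometry_conj, e, Matrix.mul_sub, Matrix.sub_mul]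

theorem mulVec_eq_zero_of_isometry_conj (hJ : Jᴴ * J = 1) {D : Matrix m m ℂ} {x : m' → ℂ}
    (hx : (J * D * Jᴴ) *ᵥ x = 0) : D *ᵥ (Jᴴ *ᵥ x) = 0 := by
  have := congrArg (fun v => Jᴴ *ᵥ v) hx
  simp only [mulVec_mulVec, mulVec_zero] at this
  rw [mulVec_mulVec, ← this]
  congr 1
  calc D * Jᴴ = Jᴴ * J * (D * Jᴴ) := by rw [hJ, Matrix.one_mul]
    _ = _ := by simp only [Matrix.mul_assoc]

theorem SVApprox.isometry_conj (hJ : Jᴴ * J = 1) (hK : Kᴴ * K = 1) {ε : ℝ} {A A' : Matrix m n ℂ}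
    {Din : Matrix m m ℂ} {Dout : Matrix n n ℂ} (h : SVApprox ε Din Dout A' A) :
    SVApprox ε (J * Din * Jᴴ) (K * Dout * Kᴴ) (J * A' * Kᴴ) (J * A * Kᴴ) := by
  obtain ⟨h1, h2, h3, h4, h5, h6, hε, -, -, h7⟩ := h
  -- The second error matrix is the first one for `Aᴴ`, with the two sides exchanged.
  have hF := schur_isometry_conj (J := K) hJ Aᴴ Dout Din
  rw [← conjTranspose_isometry_conj, conjTranspose_conjTranspose, conjTranspose_conjTranspose] at hF
  rw [SVApprox, MatrixApprox, hF, schur_isometry_conj hK]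
  refine ⟨h1.mul_mul_conjTranspose_same J, h2.mul_mul_conjTranspose_same K, fun x hx => ?_,
    fun y hy => ?_, h5.mul_mul_conjTranspose_same J, h6.mul_mul_conjTranspose_same K, hε,
    h5.mul_mul_conjTranspose_same J, h6.mul_mul_conjTranspose_same K, fun x y => ?_⟩
  · have := h3 _ (mulVec_eq_zero_of_isometry_conj hJ hx)
    rw [star_mulVec, conjTranspose_conjTranspose] at this
    rw [← vecMul_vecMul, ← vecMul_vecMul, this, zero_vecMul]
  · have := h4 _ (mulVec_eq_zero_of_isometry_conj hK hy)
    rw [← mulVec_mulVec, ← mulVec_mulVec, this, mulVec_zero]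
  · have := h7 (Jᴴ *ᵥ x) (Kᴴ *ᵥ y)
    rw [quadForm_mul_mul_conjTranspose, quadForm_mul_mul_conjTranspose]
    rwa [← Matrix.sub_mul, ← Matrix.mul_sub, ← mulVec_mulVec, ← mulVec_mulVec,
      star_dotProduct_mulVec J]

theorem sqNorm_isometry_mulVec (hJ : Jᴴ * J = 1) (x : m → ℂ) :
    sqNorm (J *ᵥ x) = sqNorm x := by
  rw [← re_star_dotProduct_self, ← re_star_dotProduct_self, star_dotProduct_mulVec, mulVec_mulVec,
    hJ, one_mulVec]

theorem sqNorm_coisometry_mulVec_le (hJ : Jᴴ * J = 1) (x : m' → ℂ) :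
    sqNorm (Jᴴ *ᵥ x) ≤ sqNorm x :=
  sqNorm_conjTranspose_mulVec_le (fun y => (sqNorm_isometry_mulVec hJ y).le) x

/-- Not a case of `SVApprox.isometry_conj`, because `J * Jᴴ` may be a proper projection. Replacing
it by the identity only enlarges the error forms, since `|Jᴴ x| ≤ |x|`. -/
theorem SVNorm.isometry_conj [DecidableEq m'] [DecidableEq n'] (hJ : Jᴴ * J = 1)
    (hK : Kᴴ * K = 1) {ε : ℝ} {A A' : Matrix m n ℂ} (h : SVNorm ε A' A) :
    SVNorm ε (J * A' * Kᴴ) (J * A * Kᴴ) := by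
  obtain ⟨hε, hA, h⟩ := svNorm_iff.mp h
  have e : ∀ y, sqNorm ((J * A * Kᴴ) *ᵥ y) = sqNorm (A *ᵥ (Kᴴ *ᵥ y)) := fun y => by
    rw [← mulVec_mulVec, ← mulVec_mulVec, sqNorm_isometry_mulVec hJ]
  have e' : ∀ x, sqNorm ((J * A * Kᴴ)ᴴ *ᵥ x) = sqNorm (Aᴴ *ᵥ (Jᴴ *ᵥ x)) := fun x => by
    rw [conjTranspose_isometry_conj, ← mulVec_mulVec, ← mulVec_mulVec, sqNorm_isometry_mulVec hK]
  refine svNorm_iff.mpr ⟨hε, fun y => ?_, fun x y => ?_⟩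
  · rw [e]
    exact (hA _).trans (sqNorm_coisometry_mulVec_le hK y)
  · rw [e, e', ← Matrix.sub_mul, ← Matrix.mul_sub, ← mulVec_mulVec, ← mulVec_mulVec,
      star_dotProduct_mulVec J]
    refine (h _ _).trans (mul_le_mul_of_nonneg_left ?_ (by linarith))
    linarith [sqNorm_coisometry_mulVec_le hJ x, sqNorm_coisometry_mulVec_le hK y]

end Isometry

/-! ### Isometries given by injections of index sets. -/

section Inclusion

variable {m n m' n' : Type*} [DecidableEq m'] [DecidableEq n']

/-- The matrix of the map that sends the basis vector `e_a` to `e_{f a}`. -/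
def inclMatrix (f : m → m') : Matrix m' m ℂ := fun r a => if r = f a then 1 else 0

theorem conjTranspose_inclMatrix (f : m → m') : (inclMatrix f)ᴴ = (inclMatrix f)ᵀ := by
  ext a r
  simp [inclMatrix, conjTranspose_apply, apply_ite]

variable [Fintype m] [Fintype n] [Fintype m'] [Fintype n']

theorem inclMatrix_isometry [DecidableEq m] {f : m → m'} (hf : Function.Injective f) :
    (inclMatrix f)ᴴ * inclMatrix f = 1 := by
  rw [conjTranspose_inclMatrix]
  ext a b
  simp [mul_apply, inclMatrix, one_apply, hf.eq_iff, eq_comm]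

theorem inclMatrix_mul_apply {f : m → m'} (hf : Function.Injective f) (A : Matrix m n ℂ)
    (a : m) (c : n) : (inclMatrix f * A) (f a) c = A a c := by
  classical
  simp [mul_apply, inclMatrix, hf.eq_iff]

theorem inclMatrix_mul_apply_of_ne {f : m → m'} (A : Matrix m n ℂ) {r : m'}
    (hr : ∀ a, r ≠ f a) (c : n) : (inclMatrix f * A) r c = 0 := by
  simp [mul_apply, inclMatrix, hr]

theorem inclMatrix_conj_apply {f : m → m'} {g : n → n'} (hf : Function.Injective f)
    (hg : Function.Injective g) (A : Matrix m n ℂ) (a : m) (b : n) :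
    (inclMatrix f * A * (inclMatrix g)ᴴ) (f a) (g b) = A a b := by
  rw [conjTranspose_inclMatrix, Matrix.mul_assoc, inclMatrix_mul_apply hf, ← transpose_apply
    (A * _), transpose_mul, transpose_transpose, inclMatrix_mul_apply hg, transpose_apply]

theorem inclMatrix_conj_apply_of_ne_left {f : m → m'} {g : n → n'} (A : Matrix m n ℂ) {r : m'}
    (hr : ∀ a, r ≠ f a) (c : n') : (inclMatrix f * A * (inclMatrix g)ᴴ) r c = 0 := by
  rw [Matrix.mul_assoc, inclMatrix_mul_apply_of_ne _ hr]

theorem inclMatrix_conj_apply_of_ne_right {f : m → m'} {g : n → n'} (A : Matrix m n ℂ) (r : m')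
    {c : n'} (hc : ∀ b, c ≠ g b) : (inclMatrix f * A * (inclMatrix g)ᴴ) r c = 0 := by
  rw [conjTranspose_inclMatrix, ← transpose_apply (_ * _), transpose_mul, transpose_transpose,
    inclMatrix_mul_apply_of_ne _ hc]

theorem one_vecMul_inclMatrix (f : m → m') : 1 ᵥ* inclMatrix f = 1 := by
  ext a
  simp [vecMul, dotProduct, inclMatrix]

theorem diagonal_inclMatrix_mulVec [DecidableEq m] (f : m → m') (v : m → ℂ) :
    diagonal (inclMatrix f *ᵥ v) = inclMatrix f * diagonal v * (inclMatrix f)ᴴ := by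
  rw [conjTranspose_inclMatrix]
  ext r c
  rw [mul_apply]
  simp only [mul_diagonal, transpose_apply, diagonal_apply, mulVec, dotProduct]
  split_ifs with h
  · subst h
    refine Finset.sum_congr rfl fun a _ => ?_
    by_cases hr : r = f a <;> simp [inclMatrix, hr]
  · refine (Finset.sum_eq_zero fun a _ => ?_).symm
    by_cases hr : r = f a
    · have : c ≠ f a := fun hc => h (hr.trans hc.symm)
      simp [inclMatrix, this]
    · simp [inclMatrix, hr]

/-- Columns of an inclusion matrix sum to `1`, so row and column sums are pushed forward along `f`
and `g`, and the degree matrices are conjugated exactly. -/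
theorem SVGraph.inclMatrix_conj [DecidableEq m] [DecidableEq n] {f : m → m'} {g : n → n'}
    (hf : Function.Injective f) (hg : Function.Injective g) {ε : ℝ} {A A' : Matrix m n ℂ}
    (h : SVGraph ε A' A) :
    SVGraph ε (inclMatrix f * A' * (inclMatrix g)ᴴ) (inclMatrix f * A * (inclMatrix g)ᴴ) := by
  obtain ⟨h0, h⟩ := h
  refine ⟨fun r c => ?_, ?_⟩
  · by_cases hr : ∃ a, r = f a
    · by_cases hc : ∃ b, c = g b
      · obtain ⟨a, rfl⟩ := hr
        obtain ⟨b, rfl⟩ := hc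
        rw [inclMatrix_conj_apply hf hg]
        exact h0 a b
      · rw [inclMatrix_conj_apply_of_ne_right A r (not_exists.mp hc)]
        simp
    · rw [inclMatrix_conj_apply_of_ne_left A (not_exists.mp hr)]
      simp
  · have e1 : (inclMatrix f * A * (inclMatrix g)ᴴ) *ᵥ 1 = inclMatrix f *ᵥ (A *ᵥ 1) := by
      rw [← mulVec_mulVec, ← mulVec_mulVec, conjTranspose_inclMatrix g, mulVec_transpose,
        one_vecMul_inclMatrix]
    have e2 : 1 ᵥ* (inclMatrix f * A * (inclMatrix g)ᴴ) = inclMatrix g *ᵥ (1 ᵥ* A) := by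
      rw [← vecMul_vecMul, ← vecMul_vecMul, conjTranspose_inclMatrix g, vecMul_transpose,
        one_vecMul_inclMatrix]
    rw [e1, e2, diagonal_inclMatrix_mulVec, diagonal_inclMatrix_mulVec]
    exact h.isometry_conj (inclMatrix_isometry hf) (inclMatrix_isometry hg)

theorem permMatrix_eq_inclMatrix (σ : Equiv.Perm m') : σ.permMatrix ℂ = inclMatrix ⇑σ⁻¹ := by
  ext r a
  simp [inclMatrix, PEquiv.toMatrix_apply, Equiv.eq_symm_apply, eq_comm]

theorem permMatrix_eq_conjTranspose_inclMatrix (σ : Equiv.Perm m') :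
    σ.permMatrix ℂ = (inclMatrix σ)ᴴ := by
  rw [← inv_inv σ, ← permMatrix_eq_inclMatrix, conjTranspose_permMatrix, inv_inv]

end Inclusion

/-! ### Contiguous blocks as inclusions. -/

section Embed

/-- The embedding of `Fin m` into `Fin (i + m + l)` as the block starting at `i`. -/
def blockEmb (i m l : ℕ) (a : Fin m) : Fin (i + m + l) := Fin.castAdd l (Fin.natAdd i a)

theorem blockEmb_injective (i m l : ℕ) : Function.Injective (blockEmb i m l) :=
  (Fin.castAdd_injective _ _).comp (Fin.natAdd_injective _ _)

theorem eq_blockEmb {i m l : ℕ} {r : Fin (i + m + l)} (h : i ≤ r.1 ∧ r.1 - i < m) :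
    r = blockEmb i m l ⟨r.1 - i, h.2⟩ := by
  ext
  simp only [blockEmb, Fin.val_castAdd, Fin.val_natAdd]
  omega

theorem ne_blockEmb {i m l : ℕ} {r : Fin (i + m + l)} (h : ¬ (i ≤ r.1 ∧ r.1 - i < m))
    (a : Fin m) : r ≠ blockEmb i m l a := by
  rintro rfl
  simp only [blockEmb, Fin.val_castAdd, Fin.val_natAdd] at h
  omega

theorem embedAt_eq (i j k l : ℕ) {m n : ℕ} (A : Matrix (Fin m) (Fin n) ℂ) :
    embedAt (i + m + l) (j + n + k) i j A =
      inclMatrix (blockEmb i m l) * A * (inclMatrix (blockEmb j n k))ᴴ := by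
  ext r c
  unfold embedAt
  split_ifs with h
  · refine (inclMatrix_conj_apply (blockEmb_injective i m l) (blockEmb_injective j n k) A _ _
      ).symm.trans ?_
    rw [← eq_blockEmb h.1, ← eq_blockEmb h.2]
  · rcases not_and_or.mp h with h | h
    · rw [inclMatrix_conj_apply_of_ne_left A (ne_blockEmb h)]
    · rw [inclMatrix_conj_apply_of_ne_right A r (ne_blockEmb h)]

end Embed

/-! ### UC approximation of symmetric walks via Dirichlet forms. -/

section UnitCircle

variable {n : Type*} [Fintype n]

/-- The Dirichlet form `∑ W u v |x u - s x v|²`; for `s = -1` it is the signless one. -/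
noncomputable def dirichlet (W : Matrix n n ℝ) (s : ℝ) (x : n → ℂ) : ℝ :=
  ∑ u, ∑ v, W u v * ‖x u - s * x v‖ ^ 2

variable [DecidableEq n]

theorem re_star_dotProduct_map_mulVec (W : Matrix n n ℝ) (x : n → ℂ) :
    (star x ⬝ᵥ (W.map Complex.ofReal *ᵥ x)).re =
      ∑ u, ∑ v, W u v * (star (x u) * x v).re := by
  simp only [dotProduct, mulVec, Finset.mul_sum, Complex.re_sum, map_apply, Pi.star_apply]
  refine Finset.sum_congr rfl fun u _ => Finset.sum_congr rfl fun v _ => ?_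
  rw [mul_left_comm, Complex.re_ofReal_mul]

theorem dirichlet_eq {W : Matrix n n ℝ} (hW : W ∈ doublyStochastic ℝ n) {s : ℝ} (hs : s ^ 2 = 1)
    (x : n → ℂ) :
    dirichlet W s x =
      2 * sqNorm x - 2 * s * (star x ⬝ᵥ (W.map Complex.ofReal *ᵥ x)).re := by
  have e : ∀ u v, W u v * ‖x u - s * x v‖ ^ 2 =
      W u v * ‖x u‖ ^ 2 + W u v * ‖x v‖ ^ 2 - 2 * s * (W u v * (star (x u) * x v).re) := by
    intro u v
    have : ‖x u - s * x v‖ ^ 2 =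
        ‖x u‖ ^ 2 + s ^ 2 * ‖x v‖ ^ 2 - 2 * s * (star (x u) * x v).re := by
      simp only [← Complex.normSq_eq_norm_sq, Complex.normSq_apply, Complex.sub_re, Complex.sub_im,
        Complex.mul_re, Complex.mul_im, Complex.ofReal_re, Complex.ofReal_im, Complex.star_def,
        Complex.conj_re, Complex.conj_im]
      ring
    rw [this, hs]
    ring
  have h1 : ∑ u, ∑ v, W u v * ‖x u‖ ^ 2 = sqNorm x := by
    simp only [← Finset.sum_mul, sum_row_of_mem_doublyStochastic hW, one_mul, sqNorm]
  have h2 : ∑ u, ∑ v, W u v * ‖x v‖ ^ 2 = sqNorm x := by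
    rw [Finset.sum_comm]
    simp only [← Finset.sum_mul, sum_col_of_mem_doublyStochastic hW, one_mul, sqNorm]
  rw [dirichlet, re_star_dotProduct_map_mulVec]
  simp only [e, Finset.sum_sub_distrib, Finset.sum_add_distrib, ← Finset.mul_sum, h1, h2]
  ring

/-- On expanding the product, the terms in a single vertex vanish by the zero row and column sums,
and symmetry makes the two cross terms equal. The sign `s` is free, so one form is controlled by
both Dirichlet forms. -/
theorem star_dotProduct_mulVec_eq_of_sum_eq_zero {D : Matrix n n ℝ} (hD : D.IsSymm)
    (hrow : ∀ u, ∑ v, D u v = 0) {s : ℝ} (hs : s ^ 2 = 1) (x y : n → ℂ) :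
    star x ⬝ᵥ (D.map Complex.ofReal *ᵥ y) =
      -(s / 2) * ∑ u, ∑ v, (D u v : ℂ) * (star (x u - s * x v) * (y u - s * y v)) := by
  have e : ∀ u v, (D u v : ℂ) * (star (x u - s * x v) * (y u - s * y v)) =
      D u v * (star (x u) * y u) + D u v * (star (x v) * y v)
        - s * (D u v * (star (x u) * y v)) - s * (D u v * (star (x v) * y u)) := by
    intro u v
    have hs' : (s : ℂ) ^ 2 = 1 := by exact_mod_cast hs
    simp only [star_sub, star_mul', Complex.star_def, Complex.conj_ofReal]
    linear_combination (D u v : ℂ) * ((starRingEnd ℂ) (x v) * y v) * hs'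
  have hrow' : ∀ u, ∑ v, (D u v : ℂ) = 0 := fun u => by exact_mod_cast hrow u
  have hcol' : ∀ v, ∑ u, (D u v : ℂ) = 0 := fun v => by
    rw [← hrow' v]
    exact Finset.sum_congr rfl fun u _ => by rw [hD.apply]
  have h1 : ∑ u, ∑ v, (D u v : ℂ) * (star (x u) * y u) = 0 := by
    simp [← Finset.sum_mul, hrow']
  have h2 : ∑ u, ∑ v, (D u v : ℂ) * (star (x v) * y v) = 0 := by
    rw [Finset.sum_comm]
    simp [← Finset.sum_mul, hcol']
  have h3 : ∑ u, ∑ v, (D u v : ℂ) * (star (x u) * y v) =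
      star x ⬝ᵥ (D.map Complex.ofReal *ᵥ y) := by
    simp only [dotProduct, mulVec, Finset.mul_sum, map_apply, Pi.star_apply]
    exact Finset.sum_congr rfl fun u _ => Finset.sum_congr rfl fun v _ => by ring
  have h4 : ∑ u, ∑ v, (D u v : ℂ) * (star (x v) * y u) =
      star x ⬝ᵥ (D.map Complex.ofReal *ᵥ y) := by
    rw [← h3, Finset.sum_comm]
    exact Finset.sum_congr rfl fun u _ => Finset.sum_congr rfl fun v _ => by rw [hD.apply]
  simp only [e, Finset.sum_sub_distrib, Finset.sum_add_distrib, ← Finset.mul_sum, h1, h2, h3, h4]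
  have hs' : (s : ℂ) ^ 2 = 1 := by exact_mod_cast hs
  linear_combination -(star x ⬝ᵥ (D.map Complex.ofReal *ᵥ y)) * hs'

theorem norm_star_dotProduct_le_dirichlet {W D : Matrix n n ℝ} (hD : D.IsSymm)
    (hrow : ∀ u, ∑ v, D u v = 0) {ε : ℝ} (h : ∀ u v, |D u v| ≤ ε * W u v) {s : ℝ}
    (hs : s ^ 2 = 1) (x y : n → ℂ) :
    ‖star x ⬝ᵥ (D.map Complex.ofReal *ᵥ y)‖ ≤
      ε / 4 * (dirichlet W s x + dirichlet W s y) := by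
  have hs1 : |s| = 1 := by rwa [← sq_eq_sq₀ (abs_nonneg s) zero_le_one, sq_abs, one_pow]
  rw [star_dotProduct_mulVec_eq_of_sum_eq_zero hD hrow hs, norm_mul]
  have h1 : ‖-((s : ℂ) / 2)‖ = 1 / 2 := by
    rw [norm_neg, norm_div, Complex.norm_real, Real.norm_eq_abs, hs1, Complex.norm_ofNat]
  have h2 : ‖∑ u, ∑ v, (D u v : ℂ) * (star (x u - s * x v) * (y u - s * y v))‖ ≤
      ∑ u, ∑ v, ε / 2 * (W u v * ‖x u - s * x v‖ ^ 2 + W u v * ‖y u - s * y v‖ ^ 2) := by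
    refine norm_sum_le_of_le _ fun u _ => norm_sum_le_of_le _ fun v _ => ?_
    rw [norm_mul, norm_mul, norm_star, Complex.norm_real, Real.norm_eq_abs]
    have h3 := h u v
    have h4 : ‖x u - s * x v‖ * ‖y u - s * y v‖ ≤
        (‖x u - s * x v‖ ^ 2 + ‖y u - s * y v‖ ^ 2) / 2 := by
      linarith [two_mul_le_add_sq ‖x u - s * x v‖ ‖y u - s * y v‖]
    calc |D u v| * (‖x u - s * x v‖ * ‖y u - s * y v‖)
        ≤ ε * W u v * ((‖x u - s * x v‖ ^ 2 + ‖y u - s * y v‖ ^ 2) / 2) :=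
          mul_le_mul h3 h4 (by positivity) ((abs_nonneg _).trans h3)
      _ = _ := by ring
  rw [h1]
  refine (mul_le_mul_of_nonneg_left h2 (by norm_num)).trans (le_of_eq ?_)
  simp only [← Finset.mul_sum, Finset.sum_add_distrib, dirichlet]
  ring

theorem isHermitian_map_ofReal {W : Matrix n n ℝ} (hW : W.IsSymm) :
    (W.map Complex.ofReal)ᴴ = W.map Complex.ofReal := by
  ext u v
  simp [hW.apply]

theorem symPart_smul {A : Matrix n n ℂ} (hA : Aᴴ = A) (z : ℂ) :
    symPart (z • A) = (z.re : ℂ) • A := by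
  rw [symPart, conjTranspose_smul, hA, ← add_smul, smul_smul, Complex.star_def, Complex.add_conj]
  congr 1
  push_cast
  ring

/-- A doubly stochastic symmetric matrix whose entries are all within a factor `1 ± ε` of those of
`W` is an `ε`-UC approximation of `W`. -/
theorem ucNorm_of_entrywise {W W' : Matrix n n ℝ} (hW : W ∈ doublyStochastic ℝ n)
    (hW' : W' ∈ doublyStochastic ℝ n) (hs : W.IsSymm) (hs' : W'.IsSymm) {ε : ℝ} (hε : 0 ≤ ε)
    (h : ∀ u v, |W' u v - W u v| ≤ ε * W u v) :
    UCNorm ε (W'.map Complex.ofReal) (W.map Complex.ofReal) := by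
  intro z hz
  obtain ⟨hc1, hc2⟩ := abs_le.mp ((Complex.abs_re_le_norm z).trans_eq hz)
  have hA := isHermitian_map_ofReal hs
  -- For Hermitian `A`, `E_z` depends only on `Re z ∈ [-1, 1]`, so it interpolates between the
  -- endpoints `z = 1` and `z = -1`.
  have hquad : ∀ x, quadForm (1 - symPart (z • W.map Complex.ofReal)) x =
      (1 + z.re) / 4 * dirichlet W 1 x + (1 - z.re) / 4 * dirichlet W (-1) x := by
    intro x
    rw [symPart_smul hA, quadForm, sub_mulVec, dotProduct_sub, one_mulVec, smul_mulVec,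
      dotProduct_smul, smul_eq_mul, Complex.sub_re, Complex.re_ofReal_mul, re_star_dotProduct_self,
      dirichlet_eq hW (by norm_num), dirichlet_eq hW (by norm_num)]
    ring
  have hnonneg : ∀ s x, 0 ≤ dirichlet W s x := fun s x =>
    Finset.sum_nonneg fun u _ => Finset.sum_nonneg fun v _ =>
      mul_nonneg (nonneg_of_mem_doublyStochastic hW) (sq_nonneg _)
  have hpsd : (1 - symPart (z • W.map Complex.ofReal)).PosSemidef := by
    refine posSemidef_of_quadForm_nonneg (isHermitian_one.sub ?_) fun x => ?_
    · rw [symPart_smul hA, IsHermitian, conjTranspose_smul, hA, Complex.star_def,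
        Complex.conj_ofReal]
    · rw [hquad]
      have := hnonneg 1 x
      have := hnonneg (-1) x
      have : 0 ≤ 1 + z.re := by linarith
      have : 0 ≤ 1 - z.re := by linarith
      positivity
  refine ⟨PosSemidef.one, hpsd, hε, hpsd, hpsd, fun x y => ?_⟩
  have hD : (W' - W).IsSymm := hs'.sub hs
  have hrow : ∀ u, ∑ v, (W' - W) u v = 0 := fun u => by
    simp [sum_row_of_mem_doublyStochastic hW, sum_row_of_mem_doublyStochastic hW']
  have hmap : z • W'.map Complex.ofReal - z • W.map Complex.ofReal =
      z • (W' - W).map Complex.ofReal := by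
    ext u v
    simp [mul_sub]
  have h1 := norm_star_dotProduct_le_dirichlet hD hrow h (s := 1) (by norm_num) x y
  have h2 := norm_star_dotProduct_le_dirichlet hD hrow h (s := -1) (by norm_num) x y
  rw [hmap, smul_mulVec, dotProduct_smul, norm_smul, hz, one_mul, hquad, hquad]
  -- The weights `(1 ± Re z) / 2` sum to `1` and reproduce the decomposition `hquad`.
  have h3 := mul_le_mul_of_nonneg_left h1 (show 0 ≤ (1 + z.re) / 2 by linarith)
  have h4 := mul_le_mul_of_nonneg_left h2 (show 0 ≤ (1 - z.re) / 2 by linarith)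
  linarith

theorem quadForm_one_sub_symPart (M : Matrix n n ℂ) (x : n → ℂ) :
    quadForm (1 - symPart M) x = sqNorm x - (star x ⬝ᵥ (M *ᵥ x)).re := by
  have h : (star x ⬝ᵥ (Mᴴ *ᵥ x)).re = (star x ⬝ᵥ (M *ᵥ x)).re := by
    rw [star_dotProduct_mulVec, conjTranspose_conjTranspose, ← star_star_dotProduct]
    rfl
  rw [quadForm, symPart, sub_mulVec, dotProduct_sub, one_mulVec, smul_mulVec, dotProduct_smul,
    add_mulVec, dotProduct_add, Complex.sub_re, re_star_dotProduct_self, smul_eq_mul]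
  have e : ((1 : ℂ) / 2) = ((1 / 2 : ℝ) : ℂ) := by push_cast; rfl
  rw [e, Complex.re_ofReal_mul, Complex.add_re, h]
  ring

/-- The `z = 1` instance of a UC approximation, tested on vectors supported on the range of `f`. -/
theorem UCNorm.submatrix_le {m : Type*} [Fintype m] [DecidableEq m] {f : m → n}
    (hf : Function.Injective f) {K : ℝ} {M M' : Matrix n n ℂ} (h : UCNorm K M' M) (x : m → ℂ) :
    ‖star x ⬝ᵥ ((M'.submatrix f f - M.submatrix f f) *ᵥ x)‖ ≤
      K * (sqNorm x - (star x ⬝ᵥ (M.submatrix f f *ᵥ x)).re) := by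
  obtain ⟨-, -, -, -, -, h⟩ := h 1 norm_one
  have key : ∀ A : Matrix n n ℂ, star (inclMatrix f *ᵥ x) ⬝ᵥ (A *ᵥ (inclMatrix f *ᵥ x)) =
      star x ⬝ᵥ (A.submatrix f f *ᵥ x) := by
    intro A
    rw [← conjTranspose_conjTranspose (inclMatrix f), ← star_dotProduct_mulVec, mulVec_mulVec,
      mulVec_mulVec]
    congr 2
    rw [conjTranspose_conjTranspose, conjTranspose_inclMatrix]
    ext a b
    simp [mul_apply, inclMatrix]
  have h1 := h (inclMatrix f *ᵥ x) (inclMatrix f *ᵥ x)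
  rw [one_smul, one_smul, key, quadForm_one_sub_symPart, key,
    sqNorm_isometry_mulVec (inclMatrix_isometry hf)] at h1
  refine h1.trans (le_of_eq ?_)
  ring

end UnitCircle

/-! ### The lazy directed cycle. -/

section LazyCycle

theorem exists_root_of_unity_near_one {δ : ℝ} (hδ : 0 < δ) :
    ∃ (k : ℕ) (ω : ℂ), ω ^ (k + 1) = 1 ∧ ‖ω‖ = 1 ∧ ω ≠ 1 ∧ ‖1 - ω‖ < δ := by
  obtain ⟨k, hk⟩ := exists_nat_gt (2 * Real.pi / δ)
  -- Order at least `2` guarantees `ω ≠ 1`.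
  have hprim := Complex.isPrimitiveRoot_exp (k + 2) (by omega)
  refine ⟨k + 1, _, hprim.pow_eq_one, hprim.norm'_eq_one (by omega),
    hprim.ne_one (by omega), ?_⟩
  have e : 2 * (Real.pi : ℂ) * Complex.I / ((k + 2 : ℕ) : ℂ) =
      Complex.I * ((2 * Real.pi / ((k + 2 : ℕ) : ℝ) : ℝ) : ℂ) := by
    push_cast
    ring
  rw [norm_sub_rev, e]
  refine (Real.norm_exp_I_mul_ofReal_sub_one_le).trans_lt ?_
  rw [Real.norm_of_nonneg (by positivity)]
  rw [div_lt_iff₀ (by positivity)]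
  rw [div_lt_iff₀ hδ] at hk
  push_cast
  nlinarith

theorem ofReal_permMatrix_apply {n : Type*} [DecidableEq n] (σ : Equiv.Perm n) (i j : n) :
    ((σ.permMatrix ℝ i j : ℝ) : ℂ) = σ.permMatrix ℂ i j := by
  by_cases h : σ i = j <;> simp [PEquiv.toMatrix_apply, h]

/-- The walk on a directed cycle of length `k + 1` that stays put with probability `a` and moves
with probability `b`. -/
def lazyCycle (k : ℕ) (a b : ℝ) : Matrix (Fin (k + 1)) (Fin (k + 1)) ℝ :=
  a • (1 : Matrix _ _ ℝ) + b • (finRotate (k + 1)).permMatrix ℝ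

theorem lazyCycle_mem_doublyStochastic (k : ℕ) {a b : ℝ} (ha : 0 ≤ a) (hb : 0 ≤ b)
    (hab : a + b = 1) : lazyCycle k a b ∈ doublyStochastic ℝ (Fin (k + 1)) :=
  convex_doublyStochastic (Submonoid.one_mem _) permMatrix_mem_doublyStochastic ha hb hab

/-- Rotation multiplies the vector of powers by `ω`; `ω ^ (k + 1) = 1` is what closes it up at the
last vertex. -/
theorem lazyCycle_mulVec (k : ℕ) (a b : ℝ) {ω : ℂ} (hω : ω ^ (k + 1) = 1) :
    (lazyCycle k a b).map Complex.ofReal *ᵥ (fun i => ω ^ (i : ℕ)) =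
      ((a : ℂ) + b * ω) • (fun i : Fin (k + 1) => ω ^ (i : ℕ)) := by
  have e : (lazyCycle k a b).map Complex.ofReal =
      (a : ℂ) • (1 : Matrix _ _ ℂ) + (b : ℂ) • (finRotate (k + 1)).permMatrix ℂ := by
    ext i j
    have h1 : (((1 : Matrix (Fin (k + 1)) (Fin (k + 1)) ℝ) i j : ℝ) : ℂ) =
        (1 : Matrix (Fin (k + 1)) (Fin (k + 1)) ℂ) i j := by
      rw [one_apply, one_apply]
      split_ifs <;> simp
    simp only [lazyCycle, map_apply, Matrix.add_apply, Matrix.smul_apply, smul_eq_mul,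
      Complex.ofReal_add, Complex.ofReal_mul, h1, ofReal_permMatrix_apply]
  have hrot : ∀ i : Fin (k + 1), ω ^ ((finRotate (k + 1) i : Fin (k + 1)) : ℕ) =
      ω * ω ^ (i : ℕ) := by
    intro i
    rw [finRotate_apply, ← pow_succ']
    by_cases hi : i = Fin.last k
    · rw [hi, Fin.last_add_one, Fin.val_last, hω, Fin.val_zero, pow_zero]
    · rw [Fin.val_add_one_of_lt (lt_of_le_of_ne (Fin.le_last i) hi)]
  rw [e, add_mulVec, smul_mulVec, smul_mulVec, one_mulVec, permMatrix_mulVec]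
  ext i
  simp only [Pi.add_apply, Pi.smul_apply, Function.comp_apply, smul_eq_mul, hrot]
  ring

/-- Slightly changing the laziness of the walk on a long directed cycle is a small entrywise
relative perturbation, but far from a UC approximation. -/
theorem exists_doublyStochastic_far {ε K : ℝ} (hε : 0 < ε) (hK : 0 < K) :
    ∃ (n : ℕ) (B B' : Matrix (Fin n) (Fin n) ℝ),
      B ∈ doublyStochastic ℝ (Fin n) ∧ B' ∈ doublyStochastic ℝ (Fin n) ∧
      (∀ u v, |B' u v - B u v| ≤ ε * B u v) ∧
      ∃ x : Fin n → ℂ, K * (sqNorm x - (star x ⬝ᵥ (B.map Complex.ofReal *ᵥ x)).re) <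
        ‖star x ⬝ᵥ ((B'.map Complex.ofReal - B.map Complex.ofReal) *ᵥ x)‖ := by
  -- `η ≤ 1 / 2` keeps the moving probability nonnegative, and `η ≤ ε / 2` makes the relative change
  -- of the weights `1 / 2` at most `ε`.
  set η := min ε 1 / 2 with hη
  have hη0 : 0 < η := by positivity
  have hη1 : η ≤ 1 / 2 := by linarith [min_le_right ε 1]
  have hηε : η ≤ ε / 2 := by linarith [min_le_left ε 1]
  -- The threshold `4 * η / K` is where `K * |1 - ω|² / 4` drops below `η * |1 - ω|`.
  obtain ⟨k, ω, hω, hω1, hne, hlt⟩ :=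
    exists_root_of_unity_near_one (show 0 < 4 * η / K by positivity)
  refine ⟨k + 1, lazyCycle k (1 / 2) (1 / 2), lazyCycle k (1 / 2 + η) (1 / 2 - η),
    lazyCycle_mem_doublyStochastic k (by norm_num) (by norm_num) (by norm_num),
    lazyCycle_mem_doublyStochastic k (by linarith) (by linarith) (by ring), fun u v => ?_,
    fun i => ω ^ (i : ℕ), ?_⟩
  · have h1 : 0 ≤ (1 : Matrix (Fin (k + 1)) (Fin (k + 1)) ℝ) u v :=
      nonneg_of_mem_doublyStochastic (Submonoid.one_mem _)
    have h2 : 0 ≤ (finRotate (k + 1)).permMatrix ℝ u v :=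
      nonneg_of_mem_doublyStochastic permMatrix_mem_doublyStochastic
    simp only [lazyCycle, Matrix.add_apply, Matrix.smul_apply, smul_eq_mul]
    rw [abs_le]
    constructor <;> nlinarith
  · set x : Fin (k + 1) → ℂ := fun i => ω ^ (i : ℕ) with hx
    have hsq : sqNorm x = k + 1 := by simp [sqNorm, hx, hω1]
    rw [sub_mulVec, lazyCycle_mulVec k _ _ hω, lazyCycle_mulVec k _ _ hω, ← sub_smul,
      dotProduct_smul, dotProduct_smul, star_dotProduct_self, hsq, smul_eq_mul, smul_eq_mul,
      norm_mul, Complex.norm_real, Complex.re_mul_ofReal, Real.norm_of_nonneg (by positivity)]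
    have e1 : (((1 / 2 + η : ℝ) : ℂ) + ((1 / 2 - η : ℝ) : ℂ) * ω -
        (((1 / 2 : ℝ) : ℂ) + ((1 / 2 : ℝ) : ℂ) * ω)) = (η : ℂ) * (1 - ω) := by
      push_cast
      ring
    -- On the unit circle `Re ω = 1 - |1 - ω|² / 2`, so the defect is quadratic in `|1 - ω|`,
    -- against the linear perturbation in `e1`.
    have e2 : ((((1 / 2 : ℝ) : ℂ) + ((1 / 2 : ℝ) : ℂ) * ω)).re = 1 - ‖1 - ω‖ ^ 2 / 4 := by
      have h1 : ω.re * ω.re + ω.im * ω.im = 1 := by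
        rw [← Complex.normSq_apply, Complex.normSq_eq_norm_sq, hω1, one_pow]
      rw [← Complex.normSq_eq_norm_sq, Complex.normSq_apply, Complex.add_re, Complex.re_ofReal_mul,
        Complex.ofReal_re, Complex.sub_re, Complex.sub_im, Complex.one_re, Complex.one_im]
      linarith
    rw [e1, e2, norm_mul, Complex.norm_real, Real.norm_of_nonneg hη0.le]
    have hpos : 0 < ‖1 - ω‖ := norm_pos_iff.mpr (sub_ne_zero.mpr hne.symm)
    rw [lt_div_iff₀ hK] at hlt
    have h3 : K * (‖1 - ω‖ ^ 2 / 4) < η * ‖1 - ω‖ := by nlinarith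
    have h4 : (0 : ℝ) < k + 1 := by positivity
    calc K * ((k : ℝ) + 1 - (1 - ‖1 - ω‖ ^ 2 / 4) * (k + 1))
        = K * (‖1 - ω‖ ^ 2 / 4) * (k + 1) := by ring
      _ < _ := mul_lt_mul_of_pos_right h3 h4

end LazyCycle

/-! ### The symmetric bipartite lift and exposing its off-diagonal block. -/

section BipartiteLift

/-- The symmetric matrix `[0, B; Bᵀ, 0]`. -/
def bipartiteLift {n : ℕ} (B : Matrix (Fin n) (Fin n) ℝ) : Matrix (Fin (n + n)) (Fin (n + n)) ℝ :=
  reindex finSumFinEquiv finSumFinEquiv (fromBlocks 0 B Bᵀ 0)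

variable {n : ℕ}

theorem bipartiteLift_apply (B : Matrix (Fin n) (Fin n) ℝ) (u v : Fin n ⊕ Fin n) :
    bipartiteLift B (finSumFinEquiv u) (finSumFinEquiv v) = fromBlocks 0 B Bᵀ 0 u v := by
  simp [bipartiteLift]

theorem bipartiteLift_isSymm (B : Matrix (Fin n) (Fin n) ℝ) : (bipartiteLift B).IsSymm := by
  rw [IsSymm, bipartiteLift, transpose_reindex, fromBlocks_transpose]
  simp

theorem bipartiteLift_mem_doublyStochastic {B : Matrix (Fin n) (Fin n) ℝ}
    (hB : B ∈ doublyStochastic ℝ (Fin n)) :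
    bipartiteLift B ∈ doublyStochastic ℝ (Fin (n + n)) := by
  refine reindex_mem_doublyStochastic ?_
  rw [mem_doublyStochastic_iff_sum]
  refine ⟨?_, ?_, ?_⟩
  · rintro (u | u) (v | v) <;> simp [nonneg_of_mem_doublyStochastic hB]
  · rintro (u | u) <;>
      simp [sum_row_of_mem_doublyStochastic hB, sum_col_of_mem_doublyStochastic hB]
  · rintro (u | u) <;>
      simp [sum_row_of_mem_doublyStochastic hB, sum_col_of_mem_doublyStochastic hB]

theorem isUndirectedWalk_bipartiteLift {B : Matrix (Fin n) (Fin n) ℝ}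
    (hB : B ∈ doublyStochastic ℝ (Fin n)) :
    IsUndirectedWalk ((bipartiteLift B).map Complex.ofReal) :=
  ⟨_, bipartiteLift_mem_doublyStochastic hB, bipartiteLift_isSymm B, rfl⟩

theorem ucNorm_bipartiteLift {B B' : Matrix (Fin n) (Fin n) ℝ}
    (hB : B ∈ doublyStochastic ℝ (Fin n)) (hB' : B' ∈ doublyStochastic ℝ (Fin n)) {ε : ℝ}
    (hε : 0 ≤ ε) (h : ∀ u v, |B' u v - B u v| ≤ ε * B u v) :
    UCNorm ε ((bipartiteLift B').map Complex.ofReal) ((bipartiteLift B).map Complex.ofReal) := by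
  refine ucNorm_of_entrywise (bipartiteLift_mem_doublyStochastic hB)
    (bipartiteLift_mem_doublyStochastic hB') (bipartiteLift_isSymm B) (bipartiteLift_isSymm B') hε
    fun u v => ?_
  obtain ⟨u, rfl⟩ := finSumFinEquiv.surjective u
  obtain ⟨v, rfl⟩ := finSumFinEquiv.surjective v
  rw [bipartiteLift_apply, bipartiteLift_apply]
  rcases u with u | u <;> rcases v with v | v <;> simp [h]

/-- The involution of `Fin (n + n)` that exchanges the two halves. -/
def halfSwap (n : ℕ) : Equiv.Perm (Fin (n + n)) :=
  finSumFinEquiv.permCongr (Equiv.sumComm (Fin n) (Fin n))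

theorem halfSwap_inv (n : ℕ) : (halfSwap n)⁻¹ = halfSwap n := by
  rw [inv_eq_iff_mul_eq_one]
  ext i
  simp [halfSwap, Equiv.permCongr_apply]

theorem halfSwap_natAdd (a : Fin n) : halfSwap n (Fin.natAdd n a) = Fin.castAdd n a := by
  rw [halfSwap, Equiv.permCongr_apply, finSumFinEquiv_symm_apply_natAdd, Equiv.sumComm_apply,
    Sum.swap_inr, finSumFinEquiv_apply_left]

/-- Swapping the two halves of the rows turns `[0, B; Bᵀ, 0]` into `[Bᵀ, 0; 0, B]`. -/
theorem submatrix_halfSwap_mul_bipartiteLift (B : Matrix (Fin n) (Fin n) ℝ) :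
    ((halfSwap n).permMatrix ℂ * (bipartiteLift B).map Complex.ofReal).submatrix
      (Fin.natAdd n) (Fin.natAdd n) = B.map Complex.ofReal := by
  ext a b
  have := bipartiteLift_apply B (Sum.inl a) (Sum.inr b)
  rw [finSumFinEquiv_apply_left, finSumFinEquiv_apply_right] at this
  rw [submatrix_apply, PEquiv.toMatrix_toPEquiv_mul, submatrix_apply, halfSwap_natAdd, id, map_apply,
    this, fromBlocks_apply₁₂, map_apply]

theorem submatrix_embedAt_bipartiteLift (B : Matrix (Fin n) (Fin n) ℝ) :
    (embedAt (n + n + n) (n + n + n) n 0 ((bipartiteLift B).map Complex.ofReal)).submatrix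
      (blockEmb n n n) (blockEmb n n n) = B.map Complex.ofReal := by
  ext a b
  have := bipartiteLift_apply B (Sum.inl a) (Sum.inr b)
  rw [finSumFinEquiv_apply_left, finSumFinEquiv_apply_right, fromBlocks_apply₁₂] at this
  rw [submatrix_apply, embedAt, dif_pos, map_apply, map_apply, ← this]
  · congr 2
    ext
    simp [blockEmb]
  · simp only [blockEmb, Fin.val_castAdd, Fin.val_natAdd]
    omega

theorem isUndirectedWalk_halfSwap (n : ℕ) : IsUndirectedWalk ((halfSwap n).permMatrix ℂ) := by
  refine ⟨(halfSwap n).permMatrix ℝ, permMatrix_mem_doublyStochastic, ?_, ?_⟩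
  · rw [IsSymm, transpose_permMatrix, halfSwap_inv]
  · ext i j
    exact (ofReal_permMatrix_apply _ i j).symm

theorem IsUndirectedWalk.ucNorm_self {A : Matrix (Fin n) (Fin n) ℂ} (hA : IsUndirectedWalk A)
    {ε : ℝ} (hε : 0 ≤ ε) : UCNorm ε A A := by
  obtain ⟨W, hW, hs, rfl⟩ := hA
  refine ucNorm_of_entrywise hW hW hs hs hε fun u v => ?_
  rw [sub_self, abs_zero]
  exact mul_nonneg hε (nonneg_of_mem_doublyStochastic hW)

end BipartiteLift

end SpectralApprox

theorem mainTheorem11 :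
    -- SV approximation is preserved under multiplication by permutation matrices
    (∀ (m n : ℕ) (ε : ℝ) (A A' : Matrix (Fin m) (Fin n) ℂ)
        (σ : Equiv.Perm (Fin m)) (τ : Equiv.Perm (Fin n)),
      (∀ (Din : Matrix (Fin m) (Fin m) ℂ) (Dout : Matrix (Fin n) (Fin n) ℂ),
        SpectralApprox.SVApprox ε Din Dout A' A →
        SpectralApprox.SVApprox ε
          (σ.permMatrix ℂ * Din * (σ.permMatrix ℂ)ᴴ) ((τ.permMatrix ℂ)ᴴ * Dout * τ.permMatrix ℂ)
          (σ.permMatrix ℂ * A' * τ.permMatrix ℂ) (σ.permMatrix ℂ * A * τ.permMatrix ℂ)) ∧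
      (SpectralApprox.SVGraph ε A' A →
        SpectralApprox.SVGraph ε
          (σ.permMatrix ℂ * A' * τ.permMatrix ℂ) (σ.permMatrix ℂ * A * τ.permMatrix ℂ)) ∧
      (SpectralApprox.SVNorm ε A' A →
        SpectralApprox.SVNorm ε
          (σ.permMatrix ℂ * A' * τ.permMatrix ℂ) (σ.permMatrix ℂ * A * τ.permMatrix ℂ))) ∧
    -- SV approximation is preserved under embedding into arbitrary block matrices
    (∀ (m n i j k l : ℕ) (ε : ℝ) (A A' : Matrix (Fin m) (Fin n) ℂ),
      (∀ (Din : Matrix (Fin m) (Fin m) ℂ) (Dout : Matrix (Fin n) (Fin n) ℂ),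
        SpectralApprox.SVApprox ε Din Dout A' A →
        SpectralApprox.SVApprox ε
          (SpectralApprox.embedAt (i + m + l) (i + m + l) i i Din)
          (SpectralApprox.embedAt (j + n + k) (j + n + k) j j Dout)
          (SpectralApprox.embedAt (i + m + l) (j + n + k) i j A')
          (SpectralApprox.embedAt (i + m + l) (j + n + k) i j A)) ∧
      (SpectralApprox.SVGraph ε A' A →
        SpectralApprox.SVGraph ε
          (SpectralApprox.embedAt (i + m + l) (j + n + k) i j A')
          (SpectralApprox.embedAt (i + m + l) (j + n + k) i j A)) ∧
      (SpectralApprox.SVNorm ε A' A →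
        SpectralApprox.SVNorm ε
          (SpectralApprox.embedAt (i + m + l) (j + n + k) i j A')
          (SpectralApprox.embedAt (i + m + l) (j + n + k) i j A))) ∧
    -- SV approximation is preserved under products, with error `ε + O(ε²)`
    (∀ ε₀ : ℝ, ε₀ < 1 → ∃ C : ℝ, 0 ≤ C ∧
      ∀ (ε : ℝ), 0 ≤ ε → ε ≤ ε₀ →
      ∀ (ℓ n : ℕ) (N N' : Fin ℓ → Matrix (Fin n) (Fin n) ℂ),
        (∀ i, SpectralApprox.SVNorm ε (N' i) (N i)) →
        SpectralApprox.SVNorm (ε + C * ε ^ 2) (SpectralApprox.descProd N') (SpectralApprox.descProd N)) ∧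
    -- UC approximation is not preserved under multiplication by permutation matrices
    (∀ ε K : ℝ, 0 < ε → 0 < K →
      ∃ (n : ℕ) (A A' : Matrix (Fin n) (Fin n) ℂ) (σ : Equiv.Perm (Fin n)),
        SpectralApprox.IsUndirectedWalk A ∧ SpectralApprox.IsUndirectedWalk A' ∧
        SpectralApprox.UCNorm ε A' A ∧
        ¬ SpectralApprox.UCNorm K (σ.permMatrix ℂ * A') (σ.permMatrix ℂ * A)) ∧
    -- UC approximation is not preserved under embedding into block matrices
    (∀ ε K : ℝ, 0 < ε → 0 < K →
      ∃ (n M i j : ℕ) (A A' : Matrix (Fin n) (Fin n) ℂ),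
        i + n ≤ M ∧ j + n ≤ M ∧
        SpectralApprox.IsUndirectedWalk A ∧ SpectralApprox.IsUndirectedWalk A' ∧
        SpectralApprox.UCNorm ε A' A ∧
        ¬ SpectralApprox.UCNorm K (SpectralApprox.embedAt M M i j A') (SpectralApprox.embedAt M M i j A)) ∧
    -- UC approximation is not preserved under products
    (∀ ε K : ℝ, 0 < ε → 0 < K →
      ∃ (n : ℕ) (A₁ A₂ A₁' A₂' : Matrix (Fin n) (Fin n) ℂ),
        SpectralApprox.IsUndirectedWalk A₁ ∧ SpectralApprox.IsUndirectedWalk A₂ ∧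
        SpectralApprox.IsUndirectedWalk A₁' ∧ SpectralApprox.IsUndirectedWalk A₂' ∧
        SpectralApprox.UCNorm ε A₁' A₁ ∧ SpectralApprox.UCNorm ε A₂' A₂ ∧
        ¬ SpectralApprox.UCNorm K (A₂' * A₁') (A₂ * A₁)) := by
  open SpectralApprox in
  refine ⟨fun m n ε A A' σ τ => ?_, fun m n i j k l ε A A' => ?_, fun ε₀ hε₀ => ?_,
    fun ε K hε hK => ?_, fun ε K hε hK => ?_, fun ε K hε hK => ?_⟩
  · have hσ := inclMatrix_isometry (σ⁻¹).injective
    have hτ := inclMatrix_isometry τ.injective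
    have hσ1 : (inclMatrix ⇑σ⁻¹ : Matrix (Fin m) (Fin m) ℂ) = σ.permMatrix ℂ :=
      (permMatrix_eq_inclMatrix σ).symm
    -- The right factor must have the form `Kᴴ`, so `τ` enters directly while the left factor uses
    -- `σ⁻¹`.
    have hτ1 : (inclMatrix ⇑τ : Matrix (Fin n) (Fin n) ℂ)ᴴ = τ.permMatrix ℂ :=
      (permMatrix_eq_conjTranspose_inclMatrix τ).symm
    have hτ2 : (inclMatrix ⇑τ : Matrix (Fin n) (Fin n) ℂ) = (τ.permMatrix ℂ)ᴴ := by
      rw [← hτ1, conjTranspose_conjTranspose]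
    rw [← hσ1, ← hτ1, conjTranspose_conjTranspose]
    exact ⟨fun Din Dout h => h.isometry_conj hσ hτ,
      fun h => h.inclMatrix_conj (σ⁻¹).injective τ.injective, fun h => h.isometry_conj hσ hτ⟩
  · have hi := blockEmb_injective i m l
    have hj := blockEmb_injective j n k
    simp only [embedAt_eq]
    exact ⟨fun Din Dout h => h.isometry_conj (inclMatrix_isometry hi) (inclMatrix_isometry hj),
      fun h => h.inclMatrix_conj hi hj,
      fun h => h.isometry_conj (inclMatrix_isometry hi) (inclMatrix_isometry hj)⟩
  · exact ⟨2 / (1 - ε₀) ^ 2, by positivity,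
      fun ε hε0 hε ℓ n N N' h => svNorm_descProd hε₀ hε0 hε N N' h⟩
  · obtain ⟨n, B, B', hB, hB', h, x, hx⟩ := exists_doublyStochastic_far hε hK
    refine ⟨n + n, _, _, halfSwap n, isUndirectedWalk_bipartiteLift hB,
      isUndirectedWalk_bipartiteLift hB', ucNorm_bipartiteLift hB hB' hε.le h, fun hU => ?_⟩
    have := hU.submatrix_le (Fin.natAdd_injective n n) x
    rw [submatrix_halfSwap_mul_bipartiteLift, submatrix_halfSwap_mul_bipartiteLift] at this
    exact this.not_gt hx
  · obtain ⟨n, B, B', hB, hB', h, x, hx⟩ := exists_doublyStochastic_far hε hK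
    -- Offsets of `n` rows and `0` columns shift the upper right block `B` down onto the diagonal.
    refine ⟨n + n, n + n + n, n, 0, _, _, by omega, by omega, isUndirectedWalk_bipartiteLift hB,
      isUndirectedWalk_bipartiteLift hB', ucNorm_bipartiteLift hB hB' hε.le h, fun hU => ?_⟩
    have := hU.submatrix_le (blockEmb_injective n n n) x
    rw [submatrix_embedAt_bipartiteLift, submatrix_embedAt_bipartiteLift] at this
    exact this.not_gt hx
  · obtain ⟨n, B, B', hB, hB', h, x, hx⟩ := exists_doublyStochastic_far hε hK
    -- The half swap is an involution, hence itself a symmetric walk. As second factor, unperturbed,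
    -- it reproduces the permutation counterexample.
    refine ⟨n + n, _, _, _, _, isUndirectedWalk_bipartiteLift hB, isUndirectedWalk_halfSwap n,
      isUndirectedWalk_bipartiteLift hB', isUndirectedWalk_halfSwap n,
      ucNorm_bipartiteLift hB hB' hε.le h, (isUndirectedWalk_halfSwap n).ucNorm_self hε.le,
      fun hU => ?_⟩
    have := hU.submatrix_le (Fin.natAdd_injective n n) x
    rw [submatrix_halfSwap_mul_bipartiteLift, submatrix_halfSwap_mul_bipartiteLift] at this
    exact this.not_gt hx
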